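/- Let $p$ be a prime, $q$ a power of $p$, $\omega=e^{2\pi i/p}$, $\operatorname{tr}$ the trace from $\mathbb F_q$ to $\mathbb F_p$, and $n\ge 0$. **Codes.** On $\mathbb C^q$ with basis $\{|x\rangle : x\in\mathbb F_q\}$ put $X(a)|x\rangle=|x+a\rangle$ and $Z(b)|x\rangle=\omega^{\operatorname{tr}(bx)}|x\rangle$. The Pauli group $\mathcal P_n$ consists of the operators $\omega^cX(a_1)Z(b_1)\otimes\cdots\otimes X(a_n)Z(b_n)$ on $\mathbb C^{q^n}$. The stabilizer of a subspace $Q\subseteq\mathbb C^{q^n}$ is the group of all elements of $\mathcal P_n$ that fix every vector of $Q$. $Q$ is an $\mathbb F_q$-linear $[[n,k]]_q$ stabilizer code if $\dim Q=q^k$, its stabilizer is abelian and contains no scalar other than $1$, $Q$ is the space of all vectors fixed by its stabilizer, and the image of the stabilizer in $\mathbb F_q^{2n}$ under $\omega^c\bigotimes_i X(a_i)Z(b_i)\mapsto(a|b)$ is an $\mathbb F_q$-subspace. A stabilizer matrix of $Q$ is then a matrix whose rows form an $\mathbb F_q$-basis of this subspace. **Symplectic matroids.** Let $J=[n]\cup[n]^*$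 with the involution $i\leftrightarrow i^*$. A subset $S\subseteq J$ is admissible if $S\cap S^*=\emptyset$; a permutation of $J$ is admissible if it commutes with $*$. Order $J$ by $n>\cdots>1>1^*>\cdots>n^*$; for an admissible permutation $w$ let $i\le^w j$ mean $w^{-1}i\le w^{-1}j$, and for sets $A=\{a_1<^w\cdots<^wa_m\}$, $B=\{b_1<^w\cdots<^wb_m\}$ let $A\le^wB$ mean $a_i\le^wb_i$ for all $i$. A symplectic matroid of rank $r$ is a collection $\mathcal B$ (the bases) of admissible $r$-subsets of $J$ such that for every admissible $w$ there is a unique $B\in\mathcal B$ with $A\le^wB$ for all $A\in\mathcal B$. It is Lagrangian if $r=n$. A matrix $M\in\mathbb F_q^{r\times 2n}$ with columns indexed by $J$ is a representation of it over $\mathbb F_q$ if the row space of $M$ is isotropic for the form $\langle(a|b),(c|d)\rangle=a\cdot d-c\cdot b$ and $\mathcal B$ is the set of admissible $r$-subsets $B$ of $J$ such that the $r\times r$ minor of $M$ with columns $B$ is nonzero. A code $Q$ induces a symplectic matroid if $Q$ has a stabilizer matrix and every stabilizer matrix of $Q$ is a representation of the matroid. **Graph states.** Let $G$ be a simple graph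 on $[n]$ whose edges $uv$ carry weights $w_{uv}\in\mathbb F_q$. Let $S$ be the group generated by the operators $K_v(a)=X_v(a)\prod_{u\in N(v)}Z_u(a\,w_{uv})$, $v\in[n]$, $a\in\mathbb F_q$. The graph state of $(G,w)$ is the space of all vectors of $\mathbb C^{q^n}$ fixed by $S$. **Corollary.** For every weighted graph $(G,w)$ as above, the graph state is an $\mathbb F_q$-linear $[[n,0]]_q$ stabilizer code with stabilizer $S$, and it induces a symplectic matroid that is representable over $\mathbb F_q$ and Lagrangian, i.e. of maximal rank $n$. -/

import Mathlib

open scoped Matrix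

namespace QuantumMatroid

/-! ### Symplectic matroids -/

/-- The ground set `J = [n] ∪ [n]*`: the element `i` is `Sum.inl i`, the element `i*` is
`Sum.inr i`. -/
abbrev J (n : ℕ) : Type := Fin n ⊕ Fin n

/-- The involution `i ↦ i*`, `i* ↦ i` on `J`. -/
def starJ {n : ℕ} : J n → J n := Sum.swap

/-- A subset `S` of `J` is admissible if `S ∩ S* = ∅`. -/
def Admissible {n : ℕ} (S : Finset (J n)) : Prop := Disjoint S (S.image starJ)

/-- The position of an element in the base ordering
`n > n-1 > ⋯ > 2 > 1 > 1* > 2* > ⋯ > n*` of `J`: `i` has position `i`, and `i*` has position `-i`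
(indices counted from `1`). -/
def position {n : ℕ} : J n → ℤ
  | Sum.inl i => (i : ℤ) + 1
  | Sum.inr i => -((i : ℤ) + 1)

/-- Admissible permutations of `J`: those which commute with the involution. -/
def AdmissiblePerm {n : ℕ} (w : Equiv.Perm (J n)) : Prop := ∀ j, w (starJ j) = starJ (w j)

/-- `i ≤^w j` if and only if `w⁻¹ i ≤ w⁻¹ j` in the base ordering. -/
def ordLE {n : ℕ} (w : Equiv.Perm (J n)) (i j : J n) : Prop :=
  position (w⁻¹ i) ≤ position (w⁻¹ j)

/-- The strict version of `ordLE`. -/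
def ordLT {n : ℕ} (w : Equiv.Perm (J n)) (i j : J n) : Prop :=
  position (w⁻¹ i) < position (w⁻¹ j)

/-- `A ≤^w B` for two subsets of the same size `m`: if `a_1 <^w ⋯ <^w a_m` and `b_1 <^w ⋯ <^w b_m`
are their increasing enumerations, then `a_i ≤^w b_i` for all `i`. -/
def setLE {n : ℕ} (w : Equiv.Perm (J n)) (A B : Finset (J n)) : Prop :=
  ∃ (m : ℕ) (a b : Fin m → J n),
    (∀ i j, i < j → ordLT w (a i) (a j)) ∧ (∀ i j, i < j → ordLT w (b i) (b j)) ∧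
    Finset.univ.image a = A ∧ Finset.univ.image b = B ∧ ∀ i, ordLE w (a i) (b i)

/-- A symplectic matroid `(J, *, 𝓑)` of rank `rank` on `J = [n] ∪ [n]*`: a collection `𝓑` of
admissible `rank`-subsets of `J` with the maximality condition. -/
structure SymplecticMatroid (n : ℕ) where
  rank : ℕ
  bases : Set (Finset (J n))
  admissible : ∀ B ∈ bases, Admissible B
  card_eq : ∀ B ∈ bases, B.card = rank
  maximality : ∀ w : Equiv.Perm (J n), AdmissiblePerm w →
    ∃! B, B ∈ bases ∧ ∀ A ∈ bases, setLE w A B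

/-- A Lagrangian matroid is a symplectic matroid whose rank is the maximal possible value `n`. -/
def SymplecticMatroid.IsLagrangian {n : ℕ} (L : SymplecticMatroid n) : Prop := L.rank = n

/-! ### Representations -/

section Representations

variable {F : Type*} [Field F]

/-- The symplectic form `⟨(a|b), (c|d)⟩ = a · d - c · b` on `F^{2n}`. -/
def symplecticForm {n : ℕ} (u v : J n → F) : F :=
  (fun i => u (Sum.inl i)) ⬝ᵥ (fun i => v (Sum.inr i)) -
    (fun i => v (Sum.inl i)) ⬝ᵥ (fun i => u (Sum.inr i))

/-- Isotropic subspaces of `F^{2n}`. -/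
def IsIsotropic {n : ℕ} (U : Submodule F (J n → F)) : Prop :=
  ∀ u ∈ U, ∀ v ∈ U, symplecticForm u v = 0

/-- The row space of a matrix. -/
def rowSpace {n r : ℕ} (M : Matrix (Fin r) (J n) F) : Submodule F (J n → F) :=
  Submodule.span F (Set.range M.row)

/-- The bases of an `r × 2n` matrix `M`, with columns indexed by `J`: the admissible `r`-subsets
`B` of `J` such that the `r × r` minor of `M` with columns `B` is nonzero. (A nonzero minor forces
the enumeration `e` of `B` to be injective, so that `B` has `r` elements.) -/
def matrixBases {n r : ℕ} (M : Matrix (Fin r) (J n) F) : Set (Finset (J n)) :=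
  {B | Admissible B ∧ ∃ e : Fin r → J n, Finset.univ.image e = B ∧ (M.submatrix id e).det ≠ 0}

/-- The matrix `M` is a representation of the symplectic matroid `L`: its row space is isotropic
and the bases of `L` are those of `M`. -/
def SymplecticMatroid.IsRepresentedBy {n r : ℕ} (L : SymplecticMatroid n)
    (M : Matrix (Fin r) (J n) F) : Prop :=
  IsIsotropic (rowSpace M) ∧ L.bases = matrixBases M

variable (F) in
/-- `L` is representable over the field `F`. -/
def SymplecticMatroid.IsRepresentable {n : ℕ} (L : SymplecticMatroid n) : Prop :=
  ∃ (r : ℕ) (M : Matrix (Fin r) (J n) F), L.IsRepresentedBy M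

end Representations

/-! ### The Pauli group on `n` systems of level `q = |F|`, `F` a finite field of characteristic `p`

The space of `n` such systems is `ℂ^{q^n}`, with the basis `|x_1 ⋯ x_n⟩`, `x ∈ F^n`. Its vectors are
functions `(Fin n → F) → ℂ`, and operators are matrices. -/

section Pauli

variable (p : ℕ) [Fact p.Prime] {F : Type*} [Field F] [Fintype F] [DecidableEq F]
  [Algebra (ZMod p) F] {n : ℕ}

/-- `ω^c` for `c ∈ ℤ/p`, where `ω = exp(2πi/p)`. -/
noncomputable def omegaPow (c : ZMod p) : ℂ := ZMod.stdAddChar c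

/-- `X(a)|x⟩ = |x + a⟩`. -/
def opX (a : F) : Matrix F F ℂ := Matrix.of fun y x => if y = x + a then 1 else 0

/-- `Z(b)|x⟩ = ω^{tr(bx)}|x⟩`, with the trace from `F` to its prime field. -/
noncomputable def opZ (b : F) : Matrix F F ℂ :=
  Matrix.diagonal fun x => omegaPow p (Algebra.trace (ZMod p) F (b * x))

/-- The tensor product `M_1 ⊗ ⋯ ⊗ M_n` of operators on the single systems. -/
def tensorOp {D : Type*} (M : Fin n → Matrix D D ℂ) : Matrix (Fin n → D) (Fin n → D) ℂ :=
  Matrix.of fun y x => ∏ i, M i (y i) (x i)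

/-- `ω^c X(a_1)Z(b_1) ⊗ ⋯ ⊗ X(a_n)Z(b_n)`. -/
noncomputable def pauliOp (c : ZMod p) (a b : Fin n → F) : Matrix (Fin n → F) (Fin n → F) ℂ :=
  omegaPow p c • tensorOp fun i => opX (a i) * opZ p (b i)

theorem omegaPow_add (c d : ZMod p) : omegaPow p (c + d) = omegaPow p c * omegaPow p d :=
  AddChar.map_add_eq_mul _ c d

theorem omegaPow_zero : omegaPow p 0 = 1 := AddChar.map_zero_eq_one _

theorem omegaPow_sum (f : Fin n → ZMod p) : omegaPow p (∑ i, f i) = ∏ i, omegaPow p (f i) :=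
  map_prod (ZMod.stdAddChar (N := p)).toMonoidHom (fun i => Multiplicative.ofAdd (f i)) _

theorem opXZ_apply (a b y x : F) : (opX a * opZ p b) y x =
    if y = x + a then omegaPow p (Algebra.trace (ZMod p) F (b * x)) else 0 := by
  simp [opX, opZ, Matrix.mul_diagonal]

theorem opXZ_mul (a b a' b' : F) : (opX a * opZ p b) * (opX a' * opZ p b') =
    omegaPow p (Algebra.trace (ZMod p) F (b * a')) • (opX (a + a') * opZ p (b + b')) := by
  ext y x
  rw [Matrix.mul_apply, Matrix.smul_apply, opXZ_apply, Finset.sum_eq_single (x + a')]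
  · rw [opXZ_apply, opXZ_apply, if_pos rfl]
    have h : x + a' + a = x + (a + a') := by ring
    rw [h]
    split_ifs
    · rw [smul_eq_mul, ← omegaPow_add, ← omegaPow_add, ← map_add, ← map_add]
      congr 2
      ring
    · simp
  · intro z _ hz
    rw [opXZ_apply p a' b', if_neg hz, mul_zero]
  · simp

theorem tensorOp_mul {D : Type*} [Fintype D] (M N : Fin n → Matrix D D ℂ) :
    tensorOp M * tensorOp N = tensorOp fun i => M i * N i := by
  ext y x
  simp only [tensorOp, Matrix.mul_apply, Matrix.of_apply, ← Finset.prod_mul_distrib]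
  rw [Fintype.prod_sum]

theorem pauliOp_mul (c c' : ZMod p) (a b a' b' : Fin n → F) :
    pauliOp p c a b * pauliOp p c' a' b' =
      pauliOp p (c + c' + ∑ i, Algebra.trace (ZMod p) F (b i * a' i)) (a + a') (b + b') := by
  simp only [pauliOp, smul_mul_smul_comm, tensorOp_mul, opXZ_mul, omegaPow_add, omegaPow_sum]
  rw [mul_smul _ (∏ i, _)]
  congr 1
  ext y x
  simp [tensorOp, Finset.prod_mul_distrib]

theorem pauliOp_zero : pauliOp p 0 (0 : Fin n → F) 0 = 1 := by
  ext y x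
  simp only [pauliOp, omegaPow_zero, one_smul, tensorOp, Matrix.of_apply, opXZ_apply,
    Pi.zero_apply, zero_mul, map_zero, add_zero, Matrix.one_apply, funext_iff]
  by_cases h : ∀ i, y i = x i
  · simp [h]
  · rw [if_neg h]
    obtain ⟨i, hi⟩ := not_forall.mp h
    exact Finset.prod_eq_zero (Finset.mem_univ i) (if_neg hi)

/-- `pauliOp p c a b` as an invertible operator. -/
noncomputable def pauli (c : ZMod p) (a b : Fin n → F) : (Matrix (Fin n → F) (Fin n → F) ℂ)ˣ where
  val := pauliOp p c a b
  inv := pauliOp p (-c + ∑ i, Algebra.trace (ZMod p) F (b i * a i)) (-a) (-b)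
  val_inv := by
    rw [pauliOp_mul, ← pauliOp_zero p]
    congr 1 <;> simp
  inv_val := by
    rw [pauliOp_mul, ← pauliOp_zero p]
    congr 1 <;> simp

variable (F n) in
/-- The generalized Pauli group `𝒫_n = {ω^c X(a_1)Z(b_1) ⊗ ⋯ ⊗ X(a_n)Z(b_n)}`. -/
noncomputable def pauliGroup : Subgroup (Matrix (Fin n → F) (Fin n → F) ℂ)ˣ where
  carrier := {g | ∃ c a b, g = pauli p c a b}
  one_mem' := ⟨0, 0, 0, Units.ext (pauliOp_zero p).symm⟩
  mul_mem' := by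
    rintro _ _ ⟨c, a, b, rfl⟩ ⟨c', a', b', rfl⟩
    exact ⟨_, _, _, Units.ext (pauliOp_mul p c c' a b a' b')⟩
  inv_mem' := by
    rintro _ ⟨c, a, b, rfl⟩
    exact ⟨_, _, _, Units.ext rfl⟩

/-! ### Stabilizer codes -/

/-- The vectors fixed by all the elements of a group `S` of operators (the joint eigenspace of `S`
with eigenvalue `1`). -/
def fixedSpace (S : Subgroup (Matrix (Fin n → F) (Fin n → F) ℂ)ˣ) :
    Submodule ℂ ((Fin n → F) → ℂ) where
  carrier := {ψ | ∀ g ∈ S, g.val *ᵥ ψ = ψ}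
  zero_mem' := fun g _ => Matrix.mulVec_zero g.val
  add_mem' := fun hφ hψ g hg => by rw [Matrix.mulVec_add, hφ g hg, hψ g hg]
  smul_mem' := fun c ψ hψ g hg => by rw [Matrix.mulVec_smul, hψ g hg]

/-- The stabilizer of a code `Q`: the elements of the Pauli group which fix every vector of `Q`. -/
noncomputable def codeStabilizer (Q : Submodule ℂ ((Fin n → F) → ℂ)) :
    Subgroup (Matrix (Fin n → F) (Fin n → F) ℂ)ˣ where
  carrier := {g | g ∈ pauliGroup p F n ∧ ∀ ψ ∈ Q, g.val *ᵥ ψ = ψ}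
  one_mem' := ⟨one_mem _, fun ψ _ => by simp⟩
  mul_mem' := fun {g h} hg hh => ⟨mul_mem hg.1 hh.1, fun ψ hψ => by
    rw [Units.val_mul, ← Matrix.mulVec_mulVec, hh.2 ψ hψ, hg.2 ψ hψ]⟩
  inv_mem' := fun {g} hg => ⟨inv_mem hg.1, fun ψ hψ => by
    conv_lhs => rw [← hg.2 ψ hψ]
    rw [Matrix.mulVec_mulVec, Units.inv_mul, Matrix.one_mulVec]⟩

/-- The image in `F^{2n}` of a group `S` of Pauli operators under
`ω^c X(a_1)Z(b_1) ⊗ ⋯ ⊗ X(a_n)Z(b_n) ↦ (a|b)`. -/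
def symplecticImage (S : Subgroup (Matrix (Fin n → F) (Fin n → F) ℂ)ˣ) : Set (J n → F) :=
  {u | ∃ c a b, pauli p c a b ∈ S ∧ u = Sum.elim a b}

/-- `Q` is an `F`-linear `[[n,k]]_q` stabilizer code, `q = |F|`: a `q^k`-dimensional subspace of
`ℂ^{q^n}`, the joint eigenspace of its stabilizer, which is an abelian subgroup of the Pauli group
without nontrivial scalars, and whose image in `F^{2n}` is an `F`-linear subspace. -/
structure IsLinearStabilizerCode (k : ℕ) (Q : Submodule ℂ ((Fin n → F) → ℂ)) : Prop where
  dim : Module.finrank ℂ Q = Fintype.card F ^ k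
  eigenspace : fixedSpace (codeStabilizer p Q) = Q
  abelian : ∀ g ∈ codeStabilizer p Q, ∀ h ∈ codeStabilizer p Q, g * h = h * g
  scalar : ∀ g ∈ codeStabilizer p Q, ∀ z : ℂ, g.val = z • 1 → g = 1
  linear : ∃ U : Submodule F (J n → F), (U : Set (J n → F)) = symplecticImage p (codeStabilizer p Q)

/-- `M` is a stabilizer matrix of the code `Q`: its rows form an `F`-basis of the image of the
stabilizer of `Q` in `F^{2n}`. -/
def IsStabilizerMatrix {r : ℕ} (Q : Submodule ℂ ((Fin n → F) → ℂ))
    (M : Matrix (Fin r) (J n) F) : Prop :=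
  LinearIndependent F M.row ∧
    (rowSpace M : Set (J n → F)) = symplecticImage p (codeStabilizer p Q)

/-- The code `Q` induces the symplectic matroid `L`: the code has a stabilizer matrix, and every
stabilizer matrix of the code is a representation of `L`. -/
def Induces (Q : Submodule ℂ ((Fin n → F) → ℂ)) (L : SymplecticMatroid n) : Prop :=
  (∃ (r : ℕ) (M : Matrix (Fin r) (J n) F), IsStabilizerMatrix p Q M) ∧
    ∀ (r : ℕ) (M : Matrix (Fin r) (J n) F), IsStabilizerMatrix p Q M → L.IsRepresentedBy M

/-! ### Graph states -/

/-- `K_v(a) = X_v(a) ∏_{u ∈ N(v)} Z_u(a w_{uv})` for a vertex `v` of the graph `G` on `[n]` with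
edge weights `w` (a vertex is not its own neighbour). -/
noncomputable def graphGenerator (G : SimpleGraph (Fin n)) [DecidableRel G.Adj]
    (w : Sym2 (Fin n) → F) (v : Fin n) (a : F) : (Matrix (Fin n → F) (Fin n → F) ℂ)ˣ :=
  pauli p 0 (Pi.single v a) (fun u => if G.Adj v u then a * w s(u, v) else 0)

/-- The stabilizer group of the weighted graph, generated by all `K_v(a)`, `v ∈ V(G)`, `a ∈ F`.
For prime `q` the operators `K_v(1)` suffice, as `K_v(a)` is then a power of `K_v(1)`; for other `q`
the multiples `a` are what makes the stabilizer `F`-linear. -/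
noncomputable def graphStabilizer (G : SimpleGraph (Fin n)) [DecidableRel G.Adj]
    (w : Sym2 (Fin n) → F) : Subgroup (Matrix (Fin n → F) (Fin n → F) ℂ)ˣ :=
  Subgroup.closure {g | ∃ v a, g = graphGenerator p G w v a}

/-- The graph state, as a subspace of `ℂ^{q^n}`: the joint eigenspace of the stabilizer group of the
weighted graph. -/
noncomputable def graphState (G : SimpleGraph (Fin n)) [DecidableRel G.Adj]
    (w : Sym2 (Fin n) → F) : Submodule ℂ ((Fin n → F) → ℂ) :=
  fixedSpace (graphStabilizer p G w)

end Pauli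

end QuantumMatroid

/-!
Let `Γ` be the weighted adjacency matrix and `T` its strictly upper triangular part. Since
`φ(a) = tr(a · T a)` satisfies `φ(a + a') = φ(a) + φ(a') + tr(Γ a · a')`, the operators
`ω^{φ(a)} X(a) Z(Γ a)` form a group, generated by the `K_v(a)`. A vector fixed by this group is
determined by its value at `0`, hence is a multiple of `∑ ω^{φ(x)} |x⟩`; conversely, because the
trace form is nondegenerate, the only Pauli operators fixing this vector are those of the group.

Two Pauli operators commute if and only if the trace of the symplectic form of their images
vanishes, so an abelian stabilizer whose image `U` is `F`-linear has isotropic image. Such a `U`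
gives a symplectic matroid: for admissible `w`, the leading coordinates (pivots) of the vectors of
`U` with respect to `≤^w` are the maximal basis. They form an admissible set, since if `u` and `v`
have leading coordinates `j` and `j*`, then `⟨u, v⟩` has exactly one nonzero term. They dominate any
other basis `A`, since the vectors of `U` supported below a position `t` inject into the
coordinates of `A` below `t`, and the dimension of the space of these vectors is the number of
pivots below `t`.
-/

namespace QuantumMatroid

/-! ### Leading coordinates and pivots -/

section Leading

variable {ι α κ : Type*} [LinearOrder α] {f : ι → α}

/-- `j` is the leading coordinate of the vector `u` when the coordinates are ordered by `f`: the
position of the nonzero entry with the largest value of `f`. -/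
def IsLeadingCoord {R : Type*} [Zero R] (f : ι → α) (u : ι → R) (j : ι) : Prop :=
  u j ≠ 0 ∧ ∀ k, f j < f k → u k = 0

theorem exists_isLeadingCoord {R : Type*} [Zero R] [Finite ι] (f : ι → α) {u : ι → R}
    (hu : u ≠ 0) : ∃ j, IsLeadingCoord f u j := by
  obtain ⟨j, hj⟩ := Set.Finite.exists_maximalFor f (Function.support u) (Set.toFinite _)
    (Function.support_nonempty_iff.mpr hu)
  exact ⟨j, hj.1, fun k hk => by_contra fun hne => hj.not_gt hne hk⟩

theorem linearIndependent_of_isLeadingCoord {R : Type*} [Ring R] [NoZeroDivisors R] [Finite κ]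
    {e : κ → ι} (he : Function.Injective (f ∘ e)) {u : κ → ι → R}
    (hu : ∀ i, IsLeadingCoord f (u i) (e i)) : LinearIndependent R u := by
  have := Fintype.ofFinite κ
  rw [Fintype.linearIndependent_iff]
  intro c hc
  by_contra! hne
  obtain ⟨i, hi, hmax⟩ := exists_isLeadingCoord (f ∘ e) (Function.ne_iff.mpr hne)
  have hsum : ∑ k, c k * u k (e i) = 0 := by simpa using congrFun hc (e i)
  rw [Finset.sum_eq_single i] at hsum
  · exact mul_ne_zero hi (hu i).1 hsum
  · intro k _ hki
    rcases (he.ne hki).lt_or_gt with hlt | hgt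
    · rw [(hu k).2 _ hlt, mul_zero]
    · rw [hmax k hgt, zero_mul]
  · simp

variable {K : Type*} [DivisionRing K]

/-- A vector of `U` is determined by its coordinates in `A`, i.e. the projection `U → K^A` is
injective. -/
def IsDeterminedOn (U : Submodule K (ι → K)) (A : Finset ι) : Prop :=
  ∀ u ∈ U, (∀ j ∈ A, u j = 0) → u = 0

theorem IsDeterminedOn.finrank_le_card {U : Submodule K (ι → K)} {A : Finset ι}
    (h : IsDeterminedOn U A) : Module.finrank K U ≤ A.card := by
  let restrict : U →ₗ[K] (A → K) := LinearMap.funLeft K K Subtype.val ∘ₗ U.subtype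
  have hinj : Function.Injective restrict := by
    rw [injective_iff_map_eq_zero]
    exact fun u hu => Subtype.ext (h u u.2 fun j hj => congrFun hu ⟨j, hj⟩)
  simpa using LinearMap.finrank_le_finrank_of_injective hinj

/-- The vectors of `U` supported on the coordinates at which `f` is smaller than `t`. -/
def supportedBelow (f : ι → α) (U : Submodule K (ι → K)) (t : α) : Submodule K (ι → K) :=
  U ⊓ Submodule.pi {k | t ≤ f k} fun _ => ⊥

theorem mem_supportedBelow {U : Submodule K (ι → K)} {t : α} {u : ι → K} :
    u ∈ supportedBelow f U t ↔ u ∈ U ∧ ∀ k, t ≤ f k → u k = 0 := by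
  simp [supportedBelow]

theorem IsDeterminedOn.supportedBelow {U : Submodule K (ι → K)} {A : Finset ι}
    (h : IsDeterminedOn U A) (f : ι → α) (t : α) :
    IsDeterminedOn (supportedBelow f U t) {j ∈ A | f j < t} := by
  intro u hu hu0
  obtain ⟨huU, hut⟩ := mem_supportedBelow.mp hu
  refine h u huU fun j hj => ?_
  rcases lt_or_ge (f j) t with hlt | hge
  · exact hu0 j (Finset.mem_filter.mpr ⟨hj, hlt⟩)
  · exact hut j hge

variable [Fintype ι]

open Classical in
/-- The pivots of `U`: the leading coordinates of its vectors when the coordinates are ordered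
by `f`. -/
noncomputable def pivots (f : ι → α) (U : Submodule K (ι → K)) : Finset ι :=
  {j | ∃ u ∈ U, IsLeadingCoord f u j}

theorem mem_pivots {U : Submodule K (ι → K)} {j : ι} :
    j ∈ pivots f U ↔ ∃ u ∈ U, IsLeadingCoord f u j := by
  simp [pivots]

theorem isDeterminedOn_pivots (f : ι → α) (U : Submodule K (ι → K)) :
    IsDeterminedOn U (pivots f U) := by
  intro u hu hu0
  by_contra hne
  obtain ⟨j, hj⟩ := exists_isLeadingCoord f hne
  exact hj.1 (hu0 j (mem_pivots.mpr ⟨u, hu, hj⟩))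

theorem card_pivots (hf : Function.Injective f) (U : Submodule K (ι → K)) :
    (pivots f U).card = Module.finrank K U := by
  refine le_antisymm ?_ (isDeterminedOn_pivots f U).finrank_le_card
  choose u hu hlead using fun j : pivots f U => mem_pivots.mp j.2
  have hli : LinearIndependent K fun j => (⟨u j, hu j⟩ : U) :=
    .of_comp U.subtype
      (linearIndependent_of_isLeadingCoord (hf.comp Subtype.val_injective) hlead)
  simpa using hli.fintype_card_le_finrank

theorem filter_pivots_lt (U : Submodule K (ι → K)) (t : α) :
    {j ∈ pivots f U | f j < t} = pivots f (supportedBelow f U t) := by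
  ext j
  simp only [Finset.mem_filter, mem_pivots, mem_supportedBelow]
  constructor
  · rintro ⟨⟨u, hu, hj⟩, hjt⟩
    exact ⟨u, ⟨hu, fun k hk => hj.2 k (hjt.trans_le hk)⟩, hj⟩
  · rintro ⟨u, ⟨hu, hut⟩, hj⟩
    exact ⟨⟨u, hu, hj⟩, lt_of_not_ge fun hge => hj.1 (hut j hge)⟩

theorem card_filter_pivots_lt_le (hf : Function.Injective f) {U : Submodule K (ι → K)}
    {A : Finset ι} (hA : IsDeterminedOn U A) (t : α) :
    {j ∈ pivots f U | f j < t}.card ≤ {j ∈ A | f j < t}.card := by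
  rw [filter_pivots_lt, card_pivots hf]
  exact (hA.supportedBelow f t).finrank_le_card

end Leading

/-! ### The order on sets of the same size -/

section Enumeration

variable {ι α : Type*} [LinearOrder α]

theorem exists_strictMono_enumeration [DecidableEq ι] {f : ι → α} (hf : Function.Injective f)
    {m : ℕ} {A : Finset ι} (hA : A.card = m) :
    ∃ a : Fin m → ι, StrictMono (f ∘ a) ∧ Finset.univ.image a = A := by
  let := LinearOrder.lift' f hf
  refine ⟨A.orderEmbOfFin hA, fun i j hij => (A.orderEmbOfFin hA).strictMono hij, ?_⟩
  convert A.image_orderEmbOfFin_univ hA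

theorem le_of_card_filter_lt_le {κ : Type*} [Fintype κ] [LinearOrder κ] {a b : κ → α}
    (ha : Monotone a) (hb : Monotone b)
    (h : ∀ t, (Finset.univ.filter (b · < t)).card ≤ (Finset.univ.filter (a · < t)).card) :
    a ≤ b := by
  intro i
  by_contra! hi
  have hsub : Finset.univ.filter (a · < a i) ⊂ Finset.univ.filter (b · < a i) := by
    refine Finset.ssubset_iff_of_subset (fun k hk => ?_) |>.mpr ⟨i, by simpa using hi, by simp⟩
    simp only [Finset.mem_filter, Finset.mem_univ, true_and] at hk ⊢
    exact (hb (ha.reflect_lt hk).le).trans_lt hi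
  exact (Finset.card_lt_card hsub).not_ge (h _)

end Enumeration

section SetOrder

variable {n : ℕ} {w : Equiv.Perm (J n)} {A B : Finset (J n)}

theorem position_starJ (j : J n) : position (starJ j) = -position j := by
  cases j <;> simp [position, starJ]

theorem position_injective : Function.Injective (position (n := n)) := by
  rintro (i | i) (j | j) h <;> simp only [position] at h
  · exact congrArg _ (Fin.ext (by omega))
  · omega
  · omega
  · exact congrArg _ (Fin.ext (by omega))

/-- The position of an element of `J` in the ordering `≤^w`, so that `ordLE w` and `ordLT w` compare
values of `wPosition w`. -/
def wPosition (w : Equiv.Perm (J n)) (j : J n) : ℤ := position (w⁻¹ j)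

theorem wPosition_injective (w : Equiv.Perm (J n)) : Function.Injective (wPosition w) :=
  position_injective.comp (w⁻¹).injective

theorem wPosition_starJ (hw : AdmissiblePerm w) (j : J n) :
    wPosition w (starJ j) = -wPosition w j := by
  have hcomm : w⁻¹ (starJ j) = starJ (w⁻¹ j) := by
    rw [Equiv.Perm.inv_eq_iff_eq, hw, Equiv.Perm.coe_inv, Equiv.apply_symm_apply]
  rw [wPosition, hcomm, position_starJ, wPosition]

theorem setLE_iff_exists_strictMono : setLE w A B ↔ ∃ (m : ℕ) (a b : Fin m → J n),
    StrictMono (wPosition w ∘ a) ∧ StrictMono (wPosition w ∘ b) ∧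
      Finset.univ.image a = A ∧ Finset.univ.image b = B ∧ wPosition w ∘ a ≤ wPosition w ∘ b :=
  Iff.rfl

theorem setLE_of_card_filter_lt_le (hAB : A.card = B.card)
    (h : ∀ t, {j ∈ B | wPosition w j < t}.card ≤ {j ∈ A | wPosition w j < t}.card) :
    setLE w A B := by
  obtain ⟨m, hB⟩ : ∃ m, B.card = m := ⟨_, rfl⟩
  obtain ⟨a, ha, rfl⟩ := exists_strictMono_enumeration (wPosition_injective w) (hAB.trans hB)
  obtain ⟨b, hb, rfl⟩ := exists_strictMono_enumeration (wPosition_injective w) hB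
  refine setLE_iff_exists_strictMono.mpr ⟨m, a, b, ha, hb, rfl, rfl,
    le_of_card_filter_lt_le ha.monotone hb.monotone fun t => ?_⟩
  simpa only [Finset.filter_image, Finset.card_image_of_injective _ ha.injective.of_comp,
    Finset.card_image_of_injective _ hb.injective.of_comp, Function.comp_apply] using h t

theorem setLE.sum_wPosition_le (h : setLE w A B) :
    ∑ j ∈ A, wPosition w j ≤ ∑ j ∈ B, wPosition w j := by
  obtain ⟨m, a, b, ha, hb, rfl, rfl, hab⟩ := setLE_iff_exists_strictMono.mp h
  rw [Finset.sum_image ha.injective.of_comp.injOn, Finset.sum_image hb.injective.of_comp.injOn]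
  exact Finset.sum_le_sum fun i _ => hab i

theorem setLE.eq_of_sum_wPosition_eq (h : setLE w A B)
    (hsum : ∑ j ∈ A, wPosition w j = ∑ j ∈ B, wPosition w j) : A = B := by
  obtain ⟨m, a, b, ha, hb, rfl, rfl, hab⟩ := setLE_iff_exists_strictMono.mp h
  rw [Finset.sum_image ha.injective.of_comp.injOn,
    Finset.sum_image hb.injective.of_comp.injOn] at hsum
  have heq := (Finset.sum_eq_sum_iff_of_le fun i _ => hab i).mp hsum
  rw [funext fun i => wPosition_injective w (heq i (Finset.mem_univ i))]

theorem setLE.antisymm (hAB : setLE w A B) (hBA : setLE w B A) : A = B :=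
  hAB.eq_of_sum_wPosition_eq (le_antisymm hAB.sum_wPosition_le hBA.sum_wPosition_le)

end SetOrder

/-! ### The symplectic matroid of an isotropic subspace -/

section Isotropic

variable {F : Type*} [Field F] {n : ℕ} {w : Equiv.Perm (J n)} {U : Submodule F (J n → F)}

theorem symplecticForm_eq_sum (u v : J n → F) :
    symplecticForm u v = ∑ j, (Sum.elim 1 (-1) : J n → F) j * (u j * v (starJ j)) := by
  simp [symplecticForm, starJ, dotProduct, mul_comm, sub_eq_add_neg]

theorem symplecticForm_smul_left (c : F) (u v : J n → F) :
    symplecticForm (c • u) v = c * symplecticForm u v := by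
  simp only [symplecticForm_eq_sum, Pi.smul_apply, smul_eq_mul, Finset.mul_sum]
  exact Finset.sum_congr rfl fun j _ => by ring

theorem symplecticForm_ne_zero_of_isLeadingCoord (hw : AdmissiblePerm w) {u v : J n → F} {j : J n}
    (hu : IsLeadingCoord (wPosition w) u j) (hv : IsLeadingCoord (wPosition w) v (starJ j)) :
    symplecticForm u v ≠ 0 := by
  rw [symplecticForm_eq_sum, Finset.sum_eq_single j]
  · refine mul_ne_zero ?_ (mul_ne_zero hu.1 hv.1)
    cases j <;> simp
  · intro k _ hkj
    rcases ((wPosition_injective w).ne hkj).lt_or_gt with hlt | hgt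
    · rw [hv.2 (starJ k) (by simpa [wPosition_starJ hw] using hlt), mul_zero, mul_zero]
    · rw [hu.2 k hgt, zero_mul, mul_zero]
  · simp

theorem IsIsotropic.admissible_pivots (hU : IsIsotropic U) (hw : AdmissiblePerm w) :
    Admissible (pivots (wPosition w) U) := by
  refine Finset.disjoint_right.mpr fun j hj hpivot => ?_
  obtain ⟨k, hk, rfl⟩ := Finset.mem_image.mp hj
  obtain ⟨u, hu, hku⟩ := mem_pivots.mp hk
  obtain ⟨v, hv, hkv⟩ := mem_pivots.mp hpivot
  exact symplecticForm_ne_zero_of_isLeadingCoord hw hku hkv (hU u hu v hv)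

/-- The admissible subsets `B` of `J` of size `dim U` for which the projection `U → F^B` is
injective (hence bijective): a description of `matrixBases` that depends only on the row space. -/
def subspaceBases (U : Submodule F (J n → F)) : Set (Finset (J n)) :=
  {B | Admissible B ∧ B.card = Module.finrank F U ∧ IsDeterminedOn U B}

theorem IsIsotropic.pivots_mem_subspaceBases (hU : IsIsotropic U) (hw : AdmissiblePerm w) :
    pivots (wPosition w) U ∈ subspaceBases U :=
  ⟨hU.admissible_pivots hw, card_pivots (wPosition_injective w) U, isDeterminedOn_pivots _ U⟩

theorem setLE_pivots {A : Finset (J n)} (hA : A ∈ subspaceBases U) :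
    setLE w A (pivots (wPosition w) U) :=
  setLE_of_card_filter_lt_le (hA.2.1.trans (card_pivots (wPosition_injective w) U).symm)
    (card_filter_pivots_lt_le (wPosition_injective w) hA.2.2)

/-- The symplectic matroid represented by the matrices with row space `U`; its maximal basis with
respect to `≤^w` is the set of pivots of `U`. -/
noncomputable def isotropicMatroid (U : Submodule F (J n → F)) (hU : IsIsotropic U) :
    SymplecticMatroid n where
  rank := Module.finrank F U
  bases := subspaceBases U
  admissible _ hB := hB.1
  card_eq _ hB := hB.2.1
  maximality w hw :=
    ⟨pivots (wPosition w) U, ⟨hU.pivots_mem_subspaceBases hw, fun _ hA => setLE_pivots hA⟩,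
      fun _ hB => (setLE_pivots hB.1).antisymm (hB.2 _ (hU.pivots_mem_subspaceBases hw))⟩

end Isotropic

section Representation

variable {F : Type*} [Field F] {n r : ℕ} {M : Matrix (Fin r) (J n) F}

theorem mem_rowSpace {u : J n → F} : u ∈ rowSpace M ↔ ∃ v, v ᵥ* M = u := by
  rw [rowSpace, ← range_vecMulLinear]
  rfl

theorem det_submatrix_ne_zero_iff (hM : LinearIndependent F M.row) (e : Fin r → J n) :
    (M.submatrix id e).det ≠ 0 ↔ IsDeterminedOn (rowSpace M) (Finset.univ.image e) := by
  have hker (v : Fin r → F) : v ᵥ* M = 0 ↔ v = 0 := by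
    rw [← (Matrix.vecMul_injective_iff.mpr hM).eq_iff, Matrix.zero_vecMul]
  have hsub (v : Fin r → F) : v ᵥ* M.submatrix id e = (v ᵥ* M) ∘ e := rfl
  have hdet : (M.submatrix id e).det ≠ 0 ↔ ∀ v : Fin r → F, (v ᵥ* M) ∘ e = 0 → v = 0 := by
    simp only [Ne, ← Matrix.exists_vecMul_eq_zero_iff, hsub, not_exists, not_and', not_not]
  simp [hdet, IsDeterminedOn, mem_rowSpace, funext_iff (f := _ ∘ e), hker]

theorem matrixBases_eq_subspaceBases (hM : LinearIndependent F M.row) :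
    matrixBases M = subspaceBases (rowSpace M) := by
  have hrank : Module.finrank F (rowSpace M) = r := by
    rw [rowSpace, finrank_span_eq_card hM, Fintype.card_fin]
  ext B
  refine and_congr_right fun _ => ?_
  rw [hrank]
  constructor
  · rintro ⟨e, rfl, hdet⟩
    refine ⟨?_, (det_submatrix_ne_zero_iff hM e).mp hdet⟩
    have hinj : Function.Injective e := fun i j hij => by_contra fun hne =>
      hdet (Matrix.det_zero_of_column_eq hne fun k => by simp [hij])
    rw [Finset.card_image_of_injective _ hinj, Finset.card_fin]
  · rintro ⟨hcard, hB⟩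
    obtain ⟨e, -, rfl⟩ := exists_strictMono_enumeration (wPosition_injective 1) hcard
    exact ⟨e, rfl, (det_submatrix_ne_zero_iff hM e).mpr hB⟩

theorem isotropicMatroid_isRepresentedBy {U : Submodule F (J n → F)} (hU : IsIsotropic U)
    (hM : LinearIndependent F M.row) (hMU : rowSpace M = U) :
    (isotropicMatroid U hU).IsRepresentedBy M := by
  subst hMU
  exact ⟨hU, (matrixBases_eq_subspaceBases hM).symm⟩

theorem exists_matrix_rowSpace_eq (U : Submodule F (J n → F)) :
    ∃ (r : ℕ) (M : Matrix (Fin r) (J n) F), LinearIndependent F M.row ∧ rowSpace M = U := by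
  obtain ⟨rows, -, hspan, hli⟩ := Submodule.exists_fun_fin_finrank_span_eq F (U : Set (J n → F))
  exact ⟨_, Matrix.of rows, hli, hspan.trans U.span_eq⟩

theorem isotropicMatroid_isRepresentable {U : Submodule F (J n → F)} (hU : IsIsotropic U) :
    (isotropicMatroid U hU).IsRepresentable F := by
  obtain ⟨r, M, hM, hMU⟩ := exists_matrix_rowSpace_eq U
  exact ⟨r, M, isotropicMatroid_isRepresentedBy hU hM hMU⟩

end Representation

/-! ### Pauli operators and stabilizer codes -/

theorem eq_zero_of_trace_mul_eq_zero {K L : Type*} [Field K] [Field L] [Algebra K L]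
    [FiniteDimensional K L] [Algebra.IsSeparable K L] {y : L}
    (h : ∀ x, Algebra.trace K L (y * x) = 0) : y = 0 :=
  (traceForm_nondegenerate K L).1 y h

theorem eq_zero_of_trace_dotProduct_eq_zero {K L ι : Type*} [Field K] [Field L] [Algebra K L]
    [FiniteDimensional K L] [Algebra.IsSeparable K L] [Fintype ι] {y : ι → L}
    (h : ∀ x, Algebra.trace K L (y ⬝ᵥ x) = 0) : y = 0 := by
  classical
  funext i
  exact eq_zero_of_trace_mul_eq_zero fun x => by simpa using h (Pi.single i x)

section Pauli

variable (p : ℕ) [Fact p.Prime]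

theorem omegaPow_injective : Function.Injective (omegaPow p) := ZMod.injective_stdAddChar

theorem omegaPow_ne_zero (c : ZMod p) : omegaPow p c ≠ 0 := fun h =>
  one_ne_zero (α := ℂ) <| by
    rw [← omegaPow_zero p, ← add_neg_cancel c, omegaPow_add, h, zero_mul]

variable {F : Type*} [Field F] [Fintype F] [DecidableEq F] [Algebra (ZMod p) F] {n : ℕ}

theorem pauli_mulVec_apply (c : ZMod p) (a b : Fin n → F) (ψ : (Fin n → F) → ℂ)
    (y : Fin n → F) : ((pauli p c a b).val *ᵥ ψ) y =
      omegaPow p (c + Algebra.trace (ZMod p) F (b ⬝ᵥ (y - a))) * ψ (y - a) := by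
  change (pauliOp p c a b *ᵥ ψ) y = _
  rw [Matrix.mulVec, dotProduct, Finset.sum_eq_single (y - a)]
  · simp [pauliOp, tensorOp, opXZ_apply, omegaPow_add, dotProduct, omegaPow_sum]
  · intro x _ hx
    obtain ⟨i, hi⟩ := Function.ne_iff.mp hx
    have hprod : ∏ i, (opX (a i) * opZ p (b i)) (y i) (x i) = 0 :=
      Finset.prod_eq_zero (Finset.mem_univ i) <| by
        rw [opXZ_apply, if_neg fun h => hi (by simp [h])]
    simp [pauliOp, tensorOp, hprod]
  · simp

theorem pauli_mul (c c' : ZMod p) (a b a' b' : Fin n → F) :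
    pauli p c a b * pauli p c' a' b' =
      pauli p (c + c' + Algebra.trace (ZMod p) F (b ⬝ᵥ a')) (a + a') (b + b') :=
  Units.ext <| (pauliOp_mul p c c' a b a' b').trans <| by rw [dotProduct, map_sum]; rfl

theorem pauli_zero : pauli p 0 (0 : Fin n → F) 0 = 1 := Units.ext (pauliOp_zero p)

theorem pauli_phase_injective (a b : Fin n → F) :
    Function.Injective fun c => pauli p c a b := by
  intro c c' h
  have hval := congrArg (fun g => (g.val *ᵥ (1 : (Fin n → F) → ℂ)) a) h
  simpa [pauli_mulVec_apply, (omegaPow_injective p).eq_iff] using hval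

theorem commute_pauli_iff (c c' : ZMod p) (a b a' b' : Fin n → F) :
    Commute (pauli p c a b) (pauli p c' a' b') ↔
      Algebra.trace (ZMod p) F (symplecticForm (Sum.elim a b) (Sum.elim a' b')) = 0 := by
  rw [Commute, SemiconjBy, pauli_mul, pauli_mul, add_comm a', add_comm b', add_comm c',
    (pauli_phase_injective p _ _).eq_iff, add_right_inj, eq_comm, ← sub_eq_zero, ← map_sub,
    dotProduct_comm b' a]
  simp [symplecticForm, dotProduct_comm]

variable {p}

theorem isIsotropic_of_commute {S : Subgroup (Matrix (Fin n → F) (Fin n → F) ℂ)ˣ}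
    (hS : ∀ g ∈ S, ∀ h ∈ S, g * h = h * g) {U : Submodule F (J n → F)}
    (hU : (U : Set (J n → F)) = symplecticImage p S) : IsIsotropic U := by
  have htrace : ∀ u ∈ U, ∀ v ∈ U, Algebra.trace (ZMod p) F (symplecticForm u v) = 0 := by
    intro u hu v hv
    rw [← SetLike.mem_coe, hU] at hu hv
    obtain ⟨c, a, b, hg, rfl⟩ := hu
    obtain ⟨c', a', b', hh, rfl⟩ := hv
    exact (commute_pauli_iff p c c' a b a' b').mp (hS _ hg _ hh)
  intro u hu v hv
  refine eq_zero_of_trace_mul_eq_zero (K := ZMod p) fun x => ?_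
  rw [mul_comm, ← symplecticForm_smul_left]
  exact htrace _ (U.smul_mem x hu) v hv

theorem eq_one_of_mem_codeStabilizer_of_eq_smul {Q : Submodule ℂ ((Fin n → F) → ℂ)} (hQ : Q ≠ ⊥)
    {g : (Matrix (Fin n → F) (Fin n → F) ℂ)ˣ} (hg : g ∈ codeStabilizer p Q) {z : ℂ}
    (hz : g.val = z • 1) : g = 1 := by
  obtain ⟨ψ, hψ, hψ0⟩ := Q.ne_bot_iff.mp hQ
  have hfix : z • ψ = (1 : ℂ) • ψ := by
    simpa [hz, Matrix.smul_mulVec] using hg.2 ψ hψ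
  have hz1 : z = 1 := smul_left_injective ℂ hψ0 hfix
  exact Units.ext (by rw [hz, hz1, one_smul, Units.val_one])

theorem induces_isotropicMatroid {Q : Submodule ℂ ((Fin n → F) → ℂ)} {U : Submodule F (J n → F)}
    (hU : IsIsotropic U) (hQ : (U : Set (J n → F)) = symplecticImage p (codeStabilizer p Q)) :
    Induces p Q (isotropicMatroid U hU) := by
  constructor
  · obtain ⟨r, M, hM, hMU⟩ := exists_matrix_rowSpace_eq U
    exact ⟨r, M, hM, by rw [hMU, hQ]⟩
  · exact fun r M hM =>
      isotropicMatroid_isRepresentedBy hU hM.1 (SetLike.coe_injective (hM.2.trans hQ.symm))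

end Pauli

/-! ### States with quadratic phases -/

section GraphSubspace

variable {F : Type*} [Field F] {n : ℕ}

/-- The subspace `{(a | Γ a)}` of `F^{2n}`, the graph of the linear map `a ↦ Γ a`. -/
def graphSubspace (Γ : Matrix (Fin n) (Fin n) F) : Submodule F (J n → F) :=
  LinearMap.range ((LinearEquiv.sumArrowLequivProdArrow (Fin n) (Fin n) F F).symm.toLinearMap ∘ₗ
    LinearMap.id.prod Γ.mulVecLin)

theorem mem_graphSubspace {Γ : Matrix (Fin n) (Fin n) F} {u : J n → F} :
    u ∈ graphSubspace Γ ↔ ∃ a, Sum.elim a (Γ *ᵥ a) = u := Iff.rfl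

theorem finrank_graphSubspace (Γ : Matrix (Fin n) (Fin n) F) :
    Module.finrank F (graphSubspace Γ) = n := by
  rw [graphSubspace, LinearMap.finrank_range_of_inj, Module.finrank_fin_fun]
  exact fun a a' h => funext fun i => congrFun h (Sum.inl i)

end GraphSubspace

section Quadratic

variable (p : ℕ) {F : Type*} [Field F] [Algebra (ZMod p) F] {n : ℕ}

/-- The phase `φ(a) = tr(a · T a)`. It is a quadratic refinement of `tr(Γ a · a')` for
`Γ = T + Tᵀ`. Using `T` rather than `Γ` avoids a division by `2`, so that even `q` is included. -/
noncomputable def quadraticPhase (T : Matrix (Fin n) (Fin n) F) (a : Fin n → F) : ZMod p :=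
  Algebra.trace (ZMod p) F (a ⬝ᵥ T *ᵥ a)

theorem quadraticPhase_zero (T : Matrix (Fin n) (Fin n) F) : quadraticPhase p T 0 = 0 := by
  simp [quadraticPhase]

theorem quadraticPhase_add (T : Matrix (Fin n) (Fin n) F) (a a' : Fin n → F) :
    quadraticPhase p T (a + a') = quadraticPhase p T a + quadraticPhase p T a' +
      Algebra.trace (ZMod p) F ((T + Tᵀ) *ᵥ a ⬝ᵥ a') := by
  have hT : a ⬝ᵥ T *ᵥ a' = Tᵀ *ᵥ a ⬝ᵥ a' := by
    rw [Matrix.mulVec_transpose, Matrix.dotProduct_mulVec]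
  simp only [quadraticPhase, ← map_add, Matrix.mulVec_add, Matrix.add_mulVec, dotProduct_add,
    add_dotProduct, hT, dotProduct_comm a' (T *ᵥ a)]
  congr 1
  ring

variable [Fact p.Prime]

/-- The vector `∑ ω^{φ(x)} |x⟩`, where `φ` is the quadratic phase of `T`. -/
noncomputable def phaseVector (T : Matrix (Fin n) (Fin n) F) (x : Fin n → F) : ℂ :=
  omegaPow p (quadraticPhase p T x)

theorem phaseVector_ne_zero (T : Matrix (Fin n) (Fin n) F) : phaseVector p T ≠ 0 := fun h =>
  omegaPow_ne_zero p _ (congrFun h 0)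

variable [Fintype F] [DecidableEq F] (T : Matrix (Fin n) (Fin n) F)

/-- The homomorphism `a ↦ ω^{φ(a)} X(a) Z(Γ a)` into the Pauli group, where `Γ = T + Tᵀ` and `φ` is
the quadratic phase of `T`, which corrects the phases arising in products of the `X(a) Z(Γ a)`. -/
noncomputable def quadraticHom :
    Multiplicative (Fin n → F) →* (Matrix (Fin n → F) (Fin n → F) ℂ)ˣ where
  toFun a := pauli p (quadraticPhase p T a.toAdd) a.toAdd ((T + Tᵀ) *ᵥ a.toAdd)
  map_one' := by simp [quadraticPhase_zero, pauli_zero]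
  map_mul' a a' := by
    rw [pauli_mul, toAdd_mul, quadraticPhase_add, Matrix.mulVec_add]

/-- The group of all Pauli operators `ω^{φ(a)} X(a) Z(Γ a)`, where `Γ = T + Tᵀ` and `φ` is the
quadratic phase of `T`. -/
noncomputable def quadraticStabilizer : Subgroup (Matrix (Fin n → F) (Fin n → F) ℂ)ˣ :=
  (quadraticHom p T).range

variable {p T}

theorem mem_quadraticStabilizer {g : (Matrix (Fin n → F) (Fin n → F) ℂ)ˣ} :
    g ∈ quadraticStabilizer p T ↔
      ∃ a, pauli p (quadraticPhase p T a) a ((T + Tᵀ) *ᵥ a) = g := Iff.rfl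

theorem quadraticStabilizer_commute {g h : (Matrix (Fin n → F) (Fin n → F) ℂ)ˣ}
    (hg : g ∈ quadraticStabilizer p T) (hh : h ∈ quadraticStabilizer p T) : g * h = h * g := by
  obtain ⟨a, rfl⟩ := hg
  obtain ⟨b, rfl⟩ := hh
  rw [← map_mul, ← map_mul, mul_comm]

theorem pauli_mulVec_phaseVector_iff {c : ZMod p} {a b : Fin n → F} :
    (pauli p c a b).val *ᵥ phaseVector p T = phaseVector p T ↔
      c = quadraticPhase p T a ∧ b = (T + Tᵀ) *ᵥ a := by
  have phases_eq : (pauli p c a b).val *ᵥ phaseVector p T = phaseVector p T ↔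
      ∀ z, c + Algebra.trace (ZMod p) F (b ⬝ᵥ z) =
        quadraticPhase p T a + Algebra.trace (ZMod p) F ((T + Tᵀ) *ᵥ a ⬝ᵥ z) := by
    rw [funext_iff, ← (Equiv.addLeft a).forall_congr_right]
    refine forall_congr' fun z => ?_
    rw [pauli_mulVec_apply, Equiv.coe_addLeft, add_sub_cancel_left, phaseVector, phaseVector,
      ← omegaPow_add, (omegaPow_injective p).eq_iff, quadraticPhase_add,
      add_right_comm (quadraticPhase p T a), add_left_inj]
  rw [phases_eq]
  constructor
  · intro h
    have hc : c = quadraticPhase p T a := by simpa using h 0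
    refine ⟨hc, sub_eq_zero.mp (eq_zero_of_trace_dotProduct_eq_zero (K := ZMod p) fun z => ?_)⟩
    rw [sub_dotProduct, map_sub, sub_eq_zero]
    simpa [hc] using h z
  · rintro ⟨rfl, rfl⟩ z
    rfl

theorem fixedSpace_quadraticStabilizer :
    fixedSpace (quadraticStabilizer p T) = ℂ ∙ phaseVector p T := by
  ext ψ
  rw [Submodule.mem_span_singleton]
  constructor
  · intro hψ
    refine ⟨ψ 0, funext fun a => ?_⟩
    have ha := congrFun (hψ _ (mem_quadraticStabilizer.mpr ⟨a, rfl⟩)) a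
    rw [← ha, pauli_mulVec_apply]
    simp [phaseVector, mul_comm]
  · rintro ⟨z, rfl⟩
    refine Submodule.smul_mem _ z fun g hg => ?_
    obtain ⟨a, rfl⟩ := mem_quadraticStabilizer.mp hg
    exact pauli_mulVec_phaseVector_iff.mpr ⟨rfl, rfl⟩

theorem codeStabilizer_span_phaseVector :
    codeStabilizer p (ℂ ∙ phaseVector p T) = quadraticStabilizer p T := by
  ext g
  constructor
  · rintro ⟨⟨c, a, b, rfl⟩, hfix⟩
    obtain ⟨rfl, rfl⟩ :=
      pauli_mulVec_phaseVector_iff.mp (hfix _ (Submodule.mem_span_singleton_self _))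
    exact mem_quadraticStabilizer.mpr ⟨a, rfl⟩
  · intro hg
    obtain ⟨a, rfl⟩ := mem_quadraticStabilizer.mp hg
    exact ⟨⟨_, _, _, rfl⟩, fun ψ hψ => (fixedSpace_quadraticStabilizer.ge hψ) _ hg⟩

theorem graphSubspace_eq_symplecticImage :
    (graphSubspace (T + Tᵀ) : Set (J n → F)) =
      symplecticImage p (codeStabilizer p (ℂ ∙ phaseVector p T)) := by
  ext u
  rw [SetLike.mem_coe, mem_graphSubspace]
  constructor
  · rintro ⟨a, rfl⟩
    refine ⟨quadraticPhase p T a, _, _, ?_, rfl⟩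
    rw [codeStabilizer_span_phaseVector]
    exact mem_quadraticStabilizer.mpr ⟨a, rfl⟩
  · rintro ⟨c, a, b, hg, rfl⟩
    obtain ⟨-, rfl⟩ :=
      pauli_mulVec_phaseVector_iff.mp (hg.2 _ (Submodule.mem_span_singleton_self _))
    exact ⟨a, rfl⟩

variable (p T) in
theorem isLinearStabilizerCode_span_phaseVector :
    IsLinearStabilizerCode p 0 (ℂ ∙ phaseVector p T) where
  dim := by rw [finrank_span_singleton (phaseVector_ne_zero p T), pow_zero]
  eigenspace := by rw [codeStabilizer_span_phaseVector, fixedSpace_quadraticStabilizer]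
  abelian := by
    rw [codeStabilizer_span_phaseVector]
    exact fun g hg h hh => quadraticStabilizer_commute hg hh
  scalar := fun _ hg _ hz => eq_one_of_mem_codeStabilizer_of_eq_smul
    (Submodule.span_singleton_eq_bot.not.mpr (phaseVector_ne_zero p T)) hg hz
  linear := ⟨graphSubspace (T + Tᵀ), graphSubspace_eq_symplecticImage⟩

end Quadratic

/-! ### Graph states -/

section Graph

variable {F : Type*} [Field F] {n : ℕ} (G : SimpleGraph (Fin n)) [DecidableRel G.Adj]
  (w : Sym2 (Fin n) → F)

/-- The strictly upper triangular part of the weighted adjacency matrix of `(G, w)`. -/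
def upperWeights : Matrix (Fin n) (Fin n) F :=
  Matrix.of fun u v => if u < v ∧ G.Adj u v then w s(u, v) else 0

theorem upperWeights_add_transpose_apply (u v : Fin n) :
    (upperWeights G w + (upperWeights G w)ᵀ) u v = if G.Adj u v then w s(u, v) else 0 := by
  rcases lt_trichotomy u v with h | rfl | h
  · simp [upperWeights, h, h.not_gt]
  · simp [upperWeights]
  · simp [upperWeights, h, h.not_gt, G.adj_comm v u, Sym2.eq_swap]

variable (p : ℕ) [Fact p.Prime] [Fintype F] [DecidableEq F] [Algebra (ZMod p) F]

theorem graphGenerator_eq_quadraticHom (v : Fin n) (a : F) :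
    graphGenerator p G w v a =
      quadraticHom p (upperWeights G w) (.ofAdd (Pi.single v a)) := by
  have hphase : quadraticPhase p (upperWeights G w) (Pi.single v a) = 0 := by
    simp [quadraticPhase, upperWeights]
  have hZ : (upperWeights G w + (upperWeights G w)ᵀ) *ᵥ Pi.single v a =
      fun u => if G.Adj v u then a * w s(u, v) else 0 := by
    funext u
    simp [upperWeights_add_transpose_apply, G.adj_comm v u, mul_comm,
      -Matrix.add_apply]
  rw [graphGenerator, ← hphase, ← hZ]
  rfl

theorem graphStabilizer_eq_quadraticStabilizer :
    graphStabilizer p G w = quadraticStabilizer p (upperWeights G w) := by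
  apply le_antisymm
  · rw [graphStabilizer, Subgroup.closure_le]
    rintro _ ⟨v, a, rfl⟩
    exact ⟨_, (graphGenerator_eq_quadraticHom G w p v a).symm⟩
  · rintro _ ⟨a, rfl⟩
    have ha : a = ∏ v, .ofAdd (Pi.single v (a.toAdd v)) := by
      rw [← ofAdd_sum, Finset.univ_sum_single, ofAdd_toAdd]
    have hmem : a ∈ (graphStabilizer p G w).comap (quadraticHom p (upperWeights G w)) := by
      rw [ha]
      exact Subgroup.prod_mem _ fun v _ => Subgroup.subset_closure
        ⟨v, a.toAdd v, (graphGenerator_eq_quadraticHom G w p v _).symm⟩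
    exact hmem

theorem graphState_eq_span :
    graphState p G w = ℂ ∙ phaseVector p (upperWeights G w) := by
  rw [graphState, graphStabilizer_eq_quadraticStabilizer, fixedSpace_quadraticStabilizer]

end Graph

end QuantumMatroid

theorem mainTheorem7 (p : ℕ) [Fact p.Prime] {F : Type*} [Field F] [Fintype F] [DecidableEq F]
    [Algebra (ZMod p) F] (n : ℕ) (G : SimpleGraph (Fin n)) [DecidableRel G.Adj]
    (w : Sym2 (Fin n) → F) :
    QuantumMatroid.IsLinearStabilizerCode p 0 (QuantumMatroid.graphState p G w) ∧
    QuantumMatroid.codeStabilizer p (QuantumMatroid.graphState p G w) =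
      QuantumMatroid.graphStabilizer p G w ∧
    ∃ L : QuantumMatroid.SymplecticMatroid n,
      QuantumMatroid.Induces p (QuantumMatroid.graphState p G w) L ∧
      L.IsRepresentable F ∧ L.IsLagrangian := by
  rw [QuantumMatroid.graphState_eq_span, QuantumMatroid.graphStabilizer_eq_quadraticStabilizer]
  have hcode := QuantumMatroid.isLinearStabilizerCode_span_phaseVector p
    (QuantumMatroid.upperWeights G w)
  have himage := QuantumMatroid.graphSubspace_eq_symplecticImage (p := p)
    (T := QuantumMatroid.upperWeights G w)
  have hU := QuantumMatroid.isIsotropic_of_commute hcode.abelian himage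
  exact ⟨hcode, QuantumMatroid.codeStabilizer_span_phaseVector,
    QuantumMatroid.isotropicMatroid _ hU,
    QuantumMatroid.induces_isotropicMatroid hU himage,
    QuantumMatroid.isotropicMatroid_isRepresentable hU,
    QuantumMatroid.finrank_graphSubspace _⟩
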